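/- Let $M$ and $B$ be closed (compact, without boundary, Hausdorff) finite-dimensional smooth manifolds. A smooth fibration $M\to B$ is a smooth surjective map $\pi\colon M\to B$ that is a locally trivial smooth fiber bundle: every point of $B$ has an open neighbourhood $U$ for which there are a smooth manifold $F$ and a diffeomorphism $\pi^{-1}(U)\to U\times F$ whose first component is $\pi$. Let $\mathrm{Fib}(M,B)$ be the set of all smooth fibrations $M\to B$, with the subspace topology of $C^\infty(M,B)$, where $C^\infty(M,B)$ carries the $C^\infty$ topology (uniform convergence, in charts and on compact sets, of all derivatives). If $\pi_0,\pi_1\in\mathrm{Fib}(M,B)$ lie in the same connected component of $\mathrm{Fib}(M,B)$, then $\pi_0$ and $\pi_1$ have diffeomorphic fibers: for all $b,b'\in B$ in the same connected component of $B$, the submanifolds $\pi_0^{-1}(b)$ and $\pi_1^{-1}(b')$ of $M$ are diffeomorphic. In particular, if $B$ is connected, every fiber of $\pi_0$ is diffeomorphic to every fiber of $\pi_1$. -/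

import Mathlib

open scoped Manifold ContDiff Topology

universe u v

section Fibrations

variable {m d : ℕ}
  {M : Type u} [TopologicalSpace M] [ChartedSpace (EuclideanSpace ℝ (Fin m)) M]
  {B : Type v} [TopologicalSpace B] [ChartedSpace (EuclideanSpace ℝ (Fin d)) B]

/-- A smooth map `π : M → B` is a (smooth) fibration, i.e. a locally trivial smooth fiber bundle:
it is surjective, and every point of `B` has an open neighbourhood `U = e.baseSet` for which there
are a smooth manifold `F` and a diffeomorphism `e : π ⁻¹' U → U × F` whose first component is `π`.
(`F` may be different over different connected components of `B`.) -/
def IsFibration (π : C^∞⟮𝓡 m, M; 𝓡 d, B⟯) : Prop :=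
  Function.Surjective π ∧
  ∀ b : B, ∃ (k : ℕ) (F : Type u) (_ : TopologicalSpace F)
    (_ : ChartedSpace (EuclideanSpace ℝ (Fin k)) F) (_ : IsManifold (𝓡 k) ∞ F)
    (e : Bundle.Trivialization F π),
    b ∈ e.baseSet ∧
    ContMDiffOn (𝓡 m) ((𝓡 d).prod (𝓡 k)) ∞ e e.source ∧
    ContMDiffOn ((𝓡 d).prod (𝓡 k)) (𝓡 m) ∞ e.toOpenPartialHomeomorph.symm e.target

/-- The basic set of maps that are `ε`-close to `f` on the compact set `K`, together with all
partial derivatives of order at most `r`, when read in the chart `φ` of `M` and the chart `ψ`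
of `B`. -/
def smoothNhd (f : C^∞⟮𝓡 m, M; 𝓡 d, B⟯)
    (φ : OpenPartialHomeomorph M (EuclideanSpace ℝ (Fin m)))
    (ψ : OpenPartialHomeomorph B (EuclideanSpace ℝ (Fin d)))
    (K : Set M) (r : ℕ) (ε : ℝ) : Set (C^∞⟮𝓡 m, M; 𝓡 d, B⟯) :=
  {g | Set.MapsTo g K ψ.source ∧
    ∀ k ≤ r, ∀ x ∈ K,
      ‖iteratedFDeriv ℝ k (ψ ∘ g ∘ φ.symm) (φ x) - iteratedFDeriv ℝ k (ψ ∘ f ∘ φ.symm) (φ x)‖ < ε}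

/-- The `C^∞` topology on `C^∞(M, B)` (uniform convergence of all derivatives in charts, on
compact sets). It is generated by the sets `smoothNhd f φ ψ K r ε`, where `φ` and `ψ` are smooth
charts and `K` is a compact subset of the domain of `φ` which `f` maps into the domain of `ψ`.
For compact `M` it is the topology of the Fréchet manifold `C^∞(M, B)`. -/
@[reducible] def smoothTopology (m d : ℕ)
    (M : Type u) [TopologicalSpace M] [ChartedSpace (EuclideanSpace ℝ (Fin m)) M]
    (B : Type v) [TopologicalSpace B] [ChartedSpace (EuclideanSpace ℝ (Fin d)) B] :
    TopologicalSpace (C^∞⟮𝓡 m, M; 𝓡 d, B⟯) :=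
  TopologicalSpace.generateFrom
    {S | ∃ (f : C^∞⟮𝓡 m, M; 𝓡 d, B⟯)
      (φ : OpenPartialHomeomorph M (EuclideanSpace ℝ (Fin m)))
      (ψ : OpenPartialHomeomorph B (EuclideanSpace ℝ (Fin d)))
      (K : Set M) (r : ℕ) (ε : ℝ),
      φ ∈ IsManifold.maximalAtlas (𝓡 m) ∞ M ∧ ψ ∈ IsManifold.maximalAtlas (𝓡 d) ∞ B ∧
      IsCompact K ∧ K ⊆ φ.source ∧ Set.MapsTo f K ψ.source ∧ 0 < ε ∧
      S = smoothNhd f φ ψ K r ε}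

/-- The space `Fib(M, B)` of all smooth fibrations `M → B`. -/
def Fib (m d : ℕ)
    (M : Type u) [TopologicalSpace M] [ChartedSpace (EuclideanSpace ℝ (Fin m)) M]
    (B : Type v) [TopologicalSpace B] [ChartedSpace (EuclideanSpace ℝ (Fin d)) B] :=
  {π : C^∞⟮𝓡 m, M; 𝓡 d, B⟯ // IsFibration π}

/-- `Fib(M, B)` carries the subspace topology of `C^∞(M, B)`. -/
instance Fib.instTopologicalSpace : TopologicalSpace (Fib m d M B) :=
  TopologicalSpace.induced Subtype.val (smoothTopology m d M B)

/-- The fiber `π ⁻¹ (b)` of a fibration, as a subset of `M`. -/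
def Fib.fiber (π : Fib m d M B) (b : B) : Set M :=
  {x | π.1 x = b}

/-- A map from a subset `S` of `M` to `M` is smooth if near each point of `S` it is the restriction
of a smooth map defined on an open subset of `M`. If `S` is an embedded submanifold, this is
smoothness for the submanifold structure of `S`. -/
def SmoothOnSubset (m : ℕ)
    {M : Type u} [TopologicalSpace M] [ChartedSpace (EuclideanSpace ℝ (Fin m)) M]
    (S : Set M) (f : S → M) : Prop :=
  ∀ x : S, ∃ (U : Set M) (g : M → M), IsOpen U ∧ (x : M) ∈ U ∧
    ContMDiffOn (𝓡 m) (𝓡 m) ∞ g U ∧ ∀ y : S, (y : M) ∈ U → g y = f y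

/-- Two subsets of `M` are diffeomorphic if there is a bijection between them which is smooth
in both directions. -/
def DiffeomorphicSubsets (m : ℕ)
    {M : Type u} [TopologicalSpace M] [ChartedSpace (EuclideanSpace ℝ (Fin m)) M]
    (S T : Set M) : Prop :=
  ∃ h : S ≃ T, SmoothOnSubset m S (fun x => (h x : M)) ∧
    SmoothOnSubset m T (fun y => (h.symm y : M))

end Fibrations

/-!
Two fibers of one fibration over nearby points are identified by a local trivialization, so the
diffeomorphism type of `π ⁻¹ (b)` is locally constant in `b`. It remains to fix `b` and to show
that it is locally constant in `π` for the `C^∞` topology. Both relations are equivalence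
relations, hence they are constant on connected components (`rel_of_mem_connectedComponent`).

Local constancy in `π` needs neither flows nor a connection. A trivialization of `π₀` near `b` gives
a smooth transport `P x c`, which moves the point `x` to the fiber of `π₀` over `c`
(`IsTransport`). In a chart `ψ` of `B` around `b`, the map `w ↦ ψ (π (P x (ψ.symm w)))` is the
identity if `π = π₀`, so for `π` close to `π₀` its derivative is within `1 / 2` of the identity on
a fixed ball around `ψ b`, uniformly for `x` in the compact fiber `π₀ ⁻¹ (b)`
(`IsTransport.eventually_norm_fderiv_sub_id_le`). By the contraction principle it takes the value
`ψ b` exactly once, at `w = σ x` say (`existsUnique_eq_center_of_hasFDerivAt_near_id`), and `σ` is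
smooth by the implicit function theorem (`contMDiffAt_of_implicit`). Then
`x ↦ P x (ψ.symm (σ x))` maps `π₀ ⁻¹ (b)` into `π ⁻¹ (b)`. The inverse is `y ↦ P y b`, because
`π ⁻¹ (b)` lies near `π₀ ⁻¹ (b)` by compactness of `M`
(`IsTransport.diffeomorphicSubsets_of_near`).
-/

/-! ### Diffeomorphic subsets of a manifold -/

section DiffeomorphicSubsets

variable {m : ℕ} {M : Type u} [TopologicalSpace M] [ChartedSpace (EuclideanSpace ℝ (Fin m)) M]

theorem DiffeomorphicSubsets.refl (S : Set M) : DiffeomorphicSubsets m S S :=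
  ⟨Equiv.refl S, fun _ => ⟨Set.univ, id, isOpen_univ, trivial, contMDiffOn_id, fun _ _ => rfl⟩,
    fun _ => ⟨Set.univ, id, isOpen_univ, trivial, contMDiffOn_id, fun _ _ => rfl⟩⟩

theorem DiffeomorphicSubsets.symm {S T : Set M} (h : DiffeomorphicSubsets m S T) :
    DiffeomorphicSubsets m T S := by
  obtain ⟨h, h₁, h₂⟩ := h
  exact ⟨h.symm, h₂, h₁⟩

theorem SmoothOnSubset.comp {S T : Set M} {f : S → T} {g : T → M}
    (hg : SmoothOnSubset m T g) (hf : SmoothOnSubset m S (fun x => (f x : M))) :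
    SmoothOnSubset m S (fun x => g (f x)) := by
  intro x
  obtain ⟨U, f', hU, hxU, hf', hff'⟩ := hf x
  obtain ⟨V, g', hV, hxV, hg', hgg'⟩ := hg (f x)
  refine ⟨U ∩ f' ⁻¹' V, g' ∘ f', hf'.continuousOn.isOpen_inter_preimage hU hV,
    ⟨hxU, by simpa [hff' x hxU] using hxV⟩, hg'.comp (hf'.mono Set.inter_subset_left)
      Set.inter_subset_right, ?_⟩
  rintro y ⟨hyU, hyV⟩
  have hy := hff' y hyU
  rw [Set.mem_preimage, hy] at hyV
  simp only [Function.comp_apply, hy]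
  exact hgg' (f y) hyV

theorem DiffeomorphicSubsets.trans {S T R : Set M} (h : DiffeomorphicSubsets m S T)
    (h' : DiffeomorphicSubsets m T R) : DiffeomorphicSubsets m S R := by
  obtain ⟨h, h₁, h₂⟩ := h
  obtain ⟨h', h₁', h₂'⟩ := h'
  exact ⟨h.trans h', h₁'.comp h₁, h₂.comp h₂'⟩

/-- Two subsets are diffeomorphic as soon as two maps, each smooth on an open neighbourhood of both
subsets, restrict to mutually inverse bijections between them. -/
theorem DiffeomorphicSubsets.of_contMDiffAt {S T W : Set M} (hW : IsOpen W) (hSW : S ⊆ W)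
    (hTW : T ⊆ W) {f g : M → M} (hf : ∀ x ∈ W, ContMDiffAt (𝓡 m) (𝓡 m) ∞ f x)
    (hg : ∀ x ∈ W, ContMDiffAt (𝓡 m) (𝓡 m) ∞ g x) (hfST : Set.MapsTo f S T)
    (hgTS : Set.MapsTo g T S) (hgf : ∀ x ∈ S, g (f x) = x) (hfg : ∀ x ∈ T, f (g x) = x) :
    DiffeomorphicSubsets m S T :=
  ⟨⟨fun x => ⟨f x, hfST x.2⟩, fun x => ⟨g x, hgTS x.2⟩, fun x => Subtype.ext (hgf x x.2),
      fun x => Subtype.ext (hfg x x.2)⟩,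
    fun x => ⟨W, f, hW, hSW x.2, fun y hy => (hf y hy).contMDiffWithinAt, fun _ _ => rfl⟩,
    fun x => ⟨W, g, hW, hTW x.2, fun y hy => (hg y hy).contMDiffWithinAt, fun _ _ => rfl⟩⟩

end DiffeomorphicSubsets

/-! ### Transport between the fibers of a fibration -/

section Transport

variable {m d : ℕ}
  {M : Type u} [TopologicalSpace M] [ChartedSpace (EuclideanSpace ℝ (Fin m)) M]
  {B : Type v} [TopologicalSpace B] [ChartedSpace (EuclideanSpace ℝ (Fin d)) B]

/-- A smooth parallel transport for `π` over the open set `U`: `P x c` is the point of the fiber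
over `c` to which a point `x` over `U` is moved. A trivialization provides one, `P x c` having the
same fiber coordinate as `x`; the fiber of the trivialization itself need not be mentioned. -/
structure IsTransport (π : C^∞⟮𝓡 m, M; 𝓡 d, B⟯) (U : Set B) (P : M → B → M) : Prop where
  isOpen : IsOpen U
  contMDiffAt : ∀ x c, π x ∈ U → c ∈ U →
    ContMDiffAt ((𝓡 m).prod (𝓡 d)) (𝓡 m) ∞ (Function.uncurry P) (x, c)
  map_eq : ∀ x c, π x ∈ U → c ∈ U → π (P x c) = c
  self : ∀ x, π x ∈ U → P x (π x) = x
  comp : ∀ x c c', π x ∈ U → c ∈ U → c' ∈ U → P (P x c) c' = P x c'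

theorem IsFibration.exists_isTransport {π : C^∞⟮𝓡 m, M; 𝓡 d, B⟯} (h : IsFibration π) (b : B) :
    ∃ (U : Set B) (P : M → B → M), b ∈ U ∧ IsTransport π U P := by
  obtain ⟨k, F, _, _, _, e, hb, he, hes⟩ := h.2 b
  refine ⟨e.baseSet, fun x c => e.toOpenPartialHomeomorph.symm (c, (e x).2), hb, e.open_baseSet,
    ?_, ?_, ?_, ?_⟩
  · intro x c hx hc
    have h₁ : ContMDiffAt (𝓡 m) ((𝓡 d).prod (𝓡 k)) ∞ e x :=
      he.contMDiffAt (e.open_source.mem_nhds (e.mem_source.2 hx))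
    have h₂ : ContMDiffAt ((𝓡 d).prod (𝓡 k)) (𝓡 m) ∞ e.toOpenPartialHomeomorph.symm
        (c, (e x).2) := hes.contMDiffAt (e.open_target.mem_nhds (e.mem_target.2 hc))
    have h₃ : ContMDiffAt ((𝓡 m).prod (𝓡 d)) ((𝓡 d).prod (𝓡 k)) ∞
        (fun p : M × B => (p.2, (e p.1).2)) (x, c) :=
      contMDiffAt_snd.prodMk (contMDiffAt_snd.comp (x, c) (h₁.comp (x, c) contMDiffAt_fst))
    exact ContMDiffAt.comp (x, c) h₂ h₃
  · intro x c _ hc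
    exact e.proj_symm_apply' hc
  · intro x hx
    exact e.symm_apply_mk_proj (e.mem_source.2 hx)
  · intro x c c' _ hc _
    rw [e.apply_symm_apply' hc]

variable {π : C^∞⟮𝓡 m, M; 𝓡 d, B⟯} {U : Set B} {P : M → B → M}

theorem IsTransport.contMDiffAt_left (hP : IsTransport π U P) {x : M} {c : B} (hx : π x ∈ U)
    (hc : c ∈ U) : ContMDiffAt (𝓡 m) (𝓡 m) ∞ (fun y => P y c) x :=
  (hP.contMDiffAt x c hx hc).comp x (contMDiffAt_id.prodMk contMDiffAt_const)

/-- Transport identifies any two fibers over the set on which it is defined. -/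
theorem IsTransport.diffeomorphicSubsets (hP : IsTransport π U P) {c c' : B} (hc : c ∈ U)
    (hc' : c' ∈ U) : DiffeomorphicSubsets m {x | π x = c} {x | π x = c'} := by
  have hSU : ∀ {c₁ : B}, c₁ ∈ U → {x | π x = c₁} ⊆ π ⁻¹' U := by
    rintro c₁ h x rfl
    exact h
  have hinv : ∀ {c₁ c₂ : B}, c₁ ∈ U → c₂ ∈ U → ∀ x ∈ {x | π x = c₁}, P (P x c₂) c₁ = x := by
    rintro c₁ c₂ h₁ h₂ x rfl
    rw [hP.comp x c₂ (π x) h₁ h₂ h₁, hP.self x h₁]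
  exact .of_contMDiffAt (hP.isOpen.preimage π.contMDiff.continuous) (hSU hc) (hSU hc')
    (fun x hx => hP.contMDiffAt_left hx hc') (fun x hx => hP.contMDiffAt_left hx hc)
    (fun x hx => hP.map_eq x c' (hSU hc hx) hc') (fun x hx => hP.map_eq x c (hSU hc' hx) hc)
    (hinv hc hc') (hinv hc' hc)

theorem rel_of_mem_connectedComponent {X : Type*} [TopologicalSpace X] {r : X → X → Prop}
    (hr : Equivalence r) (hloc : ∀ x, ∀ᶠ y in 𝓝 x, r x y) {x y : X}
    (h : y ∈ connectedComponent x) : r x y := by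
  have hcl : IsClopen {y | r x y} := by
    refine ⟨⟨isOpen_iff_mem_nhds.2 fun z hz => ?_⟩, isOpen_iff_mem_nhds.2 fun z hz => ?_⟩
    · filter_upwards [hloc z] with w hw hxw
      exact hz (hr.trans hxw (hr.symm hw))
    · filter_upwards [hloc z] with w hw
      exact hr.trans hz hw
  exact hcl.connectedComponent_subset (hr.refl x) h

theorem Fib.diffeomorphicSubsets_fiber (π : Fib m d M B) {b b' : B}
    (h : b' ∈ connectedComponent b) : DiffeomorphicSubsets m (π.fiber b) (π.fiber b') := by
  refine rel_of_mem_connectedComponent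
    (r := fun b b' => DiffeomorphicSubsets m (π.fiber b) (π.fiber b'))
    ⟨fun _ => .refl _, fun h => h.symm, fun h h' => h.trans h'⟩ (fun c => ?_) h
  obtain ⟨U, P, hc, hP⟩ := π.2.exists_isTransport c
  filter_upwards [hP.isOpen.mem_nhds hc] with c' hc'
  exact hP.diffeomorphicSubsets hc hc'

end Transport

/-! ### Neighbourhoods in the smooth topology -/

section SmoothTopology

variable {m d : ℕ}
  {M : Type u} [TopologicalSpace M] [ChartedSpace (EuclideanSpace ℝ (Fin m)) M]
  {B : Type v} [TopologicalSpace B] [ChartedSpace (EuclideanSpace ℝ (Fin d)) B]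

theorem smoothNhd_mem_nhds (f : C^∞⟮𝓡 m, M; 𝓡 d, B⟯)
    {φ : OpenPartialHomeomorph M (EuclideanSpace ℝ (Fin m))}
    {ψ : OpenPartialHomeomorph B (EuclideanSpace ℝ (Fin d))}
    (hφ : φ ∈ IsManifold.maximalAtlas (𝓡 m) ∞ M) (hψ : ψ ∈ IsManifold.maximalAtlas (𝓡 d) ∞ B)
    {K : Set M} (hK : IsCompact K) (hKφ : K ⊆ φ.source) (hKψ : Set.MapsTo f K ψ.source)
    (r : ℕ) {ε : ℝ} (hε : 0 < ε) :
    smoothNhd f φ ψ K r ε ∈ @nhds _ (smoothTopology m d M B) f := by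
  let _ := smoothTopology m d M B
  have hopen : IsOpen (smoothNhd f φ ψ K r ε) := TopologicalSpace.isOpen_generateFrom_of_mem
    ⟨f, φ, ψ, K, r, ε, hφ, hψ, hK, hKφ, hKψ, hε, rfl⟩
  refine hopen.mem_nhds ⟨hKψ, fun k _ x _ => ?_⟩
  simpa using hε

/-- The `C^∞` topology is finer than the compact-open topology. Closeness in a chart of `B`
restricted to `O` already forces the compact set to be mapped into `O`. -/
theorem eventually_mapsTo_smoothTopology [IsManifold (𝓡 m) ∞ M] [IsManifold (𝓡 d) ∞ B] [T2Space M]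
    (f : C^∞⟮𝓡 m, M; 𝓡 d, B⟯) {K : Set M} (hK : IsCompact K) {O : Set B} (hO : IsOpen O)
    (hKO : Set.MapsTo f K O) :
    ∀ᶠ g : C^∞⟮𝓡 m, M; 𝓡 d, B⟯ in @nhds _ (smoothTopology m d M B) f,
      Set.MapsTo g K O := by
  let _ := smoothTopology m d M B
  have : LocallyCompactSpace M :=
    ChartedSpace.locallyCompactSpace (EuclideanSpace ℝ (Fin m)) M
  refine hK.induction_on (p := fun s =>
    ∀ᶠ g : C^∞⟮𝓡 m, M; 𝓡 d, B⟯ in @nhds _ (smoothTopology m d M B) f, Set.MapsTo g s O)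
    (by simp [Set.mapsTo_empty]) ?_ ?_ ?_
  · intro s t hst ht
    exact ht.mono fun g hg => hg.mono_left hst
  · intro s t hs ht
    filter_upwards [hs, ht] with g h₁ h₂
    exact h₁.union h₂
  · intro x hx
    have hψ : (chartAt (EuclideanSpace ℝ (Fin d)) (f x)).restr O ∈
        IsManifold.maximalAtlas (𝓡 d) ∞ B :=
      restr_mem_maximalAtlas (contDiffGroupoid ∞ (𝓡 d)) (IsManifold.chart_mem_maximalAtlas _) hO
    have hmem : (chartAt (EuclideanSpace ℝ (Fin m)) x).source ∩
        f ⁻¹' ((chartAt (EuclideanSpace ℝ (Fin d)) (f x)).restr O).source ∈ 𝓝 x := by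
      refine Filter.inter_mem (chart_source_mem_nhds _ x)
        (f.contMDiff.continuous.continuousAt.preimage_mem_nhds
          (((chartAt _ (f x)).restr O).open_source.mem_nhds ?_))
      rw [OpenPartialHomeomorph.restr_source' _ _ hO]
      exact ⟨mem_chart_source _ _, hKO hx⟩
    obtain ⟨t, ht, htsub, htc⟩ := local_compact_nhds hmem
    refine ⟨t, mem_nhdsWithin_of_mem_nhds ht, ?_⟩
    filter_upwards [smoothNhd_mem_nhds f (IsManifold.chart_mem_maximalAtlas x) hψ htc
      (fun y hy => (htsub hy).1) (fun y hy => (htsub hy).2) 0 one_pos] with g hg y hy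
    have := hg.1 hy
    rw [OpenPartialHomeomorph.restr_source' _ _ hO] at this
    exact this.2

end SmoothTopology

/-! ### Derivative of nearby maps along a transport -/

section FiberDerivative

theorem norm_iteratedFDeriv_one_sub {E F : Type*} [NormedAddCommGroup E] [NormedSpace ℝ E]
    [NormedAddCommGroup F] [NormedSpace ℝ F] {f g : E → F} {x : E} (hf : ContDiffAt ℝ 1 f x)
    (hg : ContDiffAt ℝ 1 g x) :
    ‖iteratedFDeriv ℝ 1 f x - iteratedFDeriv ℝ 1 g x‖ = ‖fderiv ℝ f x - fderiv ℝ g x‖ := by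
  rw [← iteratedFDeriv_sub_apply hf hg, norm_iteratedFDeriv_one,
    fderiv_sub (hf.differentiableAt one_ne_zero) (hg.differentiableAt one_ne_zero)]

variable {m d : ℕ}
  {M : Type u} [TopologicalSpace M] [ChartedSpace (EuclideanSpace ℝ (Fin m)) M]
  {B : Type v} [TopologicalSpace B] [ChartedSpace (EuclideanSpace ℝ (Fin d)) B]
  {φ : OpenPartialHomeomorph M (EuclideanSpace ℝ (Fin m))}
  {ψ : OpenPartialHomeomorph B (EuclideanSpace ℝ (Fin d))}
  {π : C^∞⟮𝓡 m, M; 𝓡 d, B⟯} {U : Set B} {P : M → B → M}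

theorem contDiffAt_chart_comp [IsManifold (𝓡 m) ∞ M] [IsManifold (𝓡 d) ∞ B]
    (g : C^∞⟮𝓡 m, M; 𝓡 d, B⟯) (hφ : φ ∈ IsManifold.maximalAtlas (𝓡 m) ∞ M)
    (hψ : ψ ∈ IsManifold.maximalAtlas (𝓡 d) ∞ B) {x : M} (hx : x ∈ φ.source)
    (hgx : g x ∈ ψ.source) : ContDiffAt ℝ ∞ (ψ ∘ g ∘ φ.symm) (φ x) := by
  rw [← contMDiffAt_iff_contDiffAt]
  have h₁ := contMDiffAt_symm_of_mem_maximalAtlas hφ (φ.map_source hx)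
  have h₂ := contMDiffAt_of_mem_maximalAtlas hψ hgx
  have h₃ : ContMDiffAt (𝓡 m) (𝓡 d) ∞ g x := g.contMDiff x
  exact ContMDiffAt.comp_of_eq (g := ψ ∘ g) (h₂.comp x h₃) h₁ (φ.left_inv hx)

/-- A transport is smooth as a function of the point and of the chart coordinates of the fiber to
which the point is moved. -/
theorem IsTransport.contMDiffAt_chart [IsManifold (𝓡 d) ∞ B] (hP : IsTransport π U P)
    (hψ : ψ ∈ IsManifold.maximalAtlas (𝓡 d) ∞ B) {x : M} {w : EuclideanSpace ℝ (Fin d)}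
    (hx : π x ∈ U) (hw : w ∈ ψ.target) (hwU : ψ.symm w ∈ U) :
    ContMDiffAt ((𝓡 m).prod (𝓡 d)) (𝓡 m) ∞
      (fun p : M × EuclideanSpace ℝ (Fin d) => P p.1 (ψ.symm p.2)) (x, w) := by
  have h₁ := contMDiffAt_symm_of_mem_maximalAtlas hψ hw
  have h₂ : ContMDiffAt ((𝓡 m).prod (𝓡 d)) ((𝓡 m).prod (𝓡 d)) ∞
      (fun p : M × EuclideanSpace ℝ (Fin d) => (p.1, ψ.symm p.2)) (x, w) :=
    contMDiffAt_fst.prodMk (h₁.comp (x, w) contMDiffAt_snd)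
  exact ContMDiffAt.comp (x, w) (hP.contMDiffAt x (ψ.symm w) hx hwU) h₂

/-- A map smooth on a product of a manifold and a vector space, read in a chart of the manifold. -/
theorem ContMDiffAt.contDiffAt_comp_symm_prod [IsManifold (𝓡 m) ∞ M]
    {E F : Type*} [NormedAddCommGroup E] [NormedSpace ℝ E] [NormedAddCommGroup F] [NormedSpace ℝ F]
    (hφ : φ ∈ IsManifold.maximalAtlas (𝓡 m) ∞ M) {f : M × E → F} {x : M} {w : E}
    (hx : x ∈ φ.source)
    (hf : ContMDiffAt ((𝓡 m).prod 𝓘(ℝ, E)) 𝓘(ℝ, F) ∞ f (x, w)) :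
    ContDiffAt ℝ ∞ (fun p : EuclideanSpace ℝ (Fin m) × E => f (φ.symm p.1, p.2)) (φ x, w) := by
  rw [← contMDiffAt_iff_contDiffAt]
  have h₁ := contMDiffAt_symm_of_mem_maximalAtlas hφ (φ.map_source hx)
  have h₂ : ContMDiffAt 𝓘(ℝ, EuclideanSpace ℝ (Fin m) × E) ((𝓡 m).prod 𝓘(ℝ, E)) ∞
      (fun p : EuclideanSpace ℝ (Fin m) × E => (φ.symm p.1, p.2)) (φ x, w) :=
    (h₁.comp (φ x, w) contDiffAt_fst.contMDiffAt).prodMk contDiffAt_snd.contMDiffAt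
  exact ContMDiffAt.comp_of_eq hf h₂ (by simp [φ.left_inv hx])

/-- For `π` near `π₀` and near a given point, the map `w ↦ ψ (π (P x (ψ.symm w)))`, which for
`π = π₀` is the identity, has derivative close to the identity. -/
theorem IsTransport.eventually_norm_fderiv_sub_id_le [IsManifold (𝓡 m) ∞ M] [IsManifold (𝓡 d) ∞ B]
    [T2Space M] {π₀ : C^∞⟮𝓡 m, M; 𝓡 d, B⟯} (hP : IsTransport π₀ U P)
    (hψ : ψ ∈ IsManifold.maximalAtlas (𝓡 d) ∞ B) (x₀ : M) (hx₀ : π₀ x₀ ∈ U)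
    (hx₀ψ : π₀ x₀ ∈ ψ.source) :
    ∃ V ∈ 𝓝 x₀, ∃ r > 0,
      ∀ᶠ π : C^∞⟮𝓡 m, M; 𝓡 d, B⟯ in @nhds _ (smoothTopology m d M B) π₀,
        ∀ x ∈ V, ∀ w ∈ Metric.ball (ψ (π₀ x₀)) r, π (P x (ψ.symm w)) ∈ ψ.source ∧
          ∃ L : EuclideanSpace ℝ (Fin d) →L[ℝ] EuclideanSpace ℝ (Fin d),
            HasFDerivAt (fun w => ψ (π (P x (ψ.symm w)))) L w ∧
              ‖L - ContinuousLinearMap.id ℝ _‖ ≤ 1 / 2 := by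
  have : LocallyCompactSpace M :=
    ChartedSpace.locallyCompactSpace (EuclideanSpace ℝ (Fin m)) M
  set φ := chartAt (EuclideanSpace ℝ (Fin m)) x₀
  have hφ : φ ∈ IsManifold.maximalAtlas (𝓡 m) ∞ M := IsManifold.chart_mem_maximalAtlas x₀
  have hxφ : x₀ ∈ φ.source := mem_chart_source _ x₀
  obtain ⟨K, hK, hKsub, hKc⟩ := local_compact_nhds (Filter.inter_mem (φ.open_source.mem_nhds hxφ)
    (π₀.contMDiff.continuous.continuousAt.preimage_mem_nhds (ψ.open_source.mem_nhds hx₀ψ)))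
  set w₀ := ψ (π₀ x₀) with hw₀
  have hw₀t : w₀ ∈ ψ.target := ψ.map_source hx₀ψ
  have hw₀s : ψ.symm w₀ = π₀ x₀ := ψ.left_inv hx₀ψ
  -- `s` is the transport read in the charts; its derivative is bounded by `C` near `(φ x₀, w₀)`.
  let T : M × EuclideanSpace ℝ (Fin d) → M := fun p => P p.1 (ψ.symm p.2)
  have hT₀ : T (x₀, w₀) = x₀ := by simp only [T, hw₀s, hP.self x₀ hx₀]
  have hT : ∀ x w, π₀ x ∈ U → w ∈ ψ.target → ψ.symm w ∈ U →
      ContMDiffAt ((𝓡 m).prod (𝓡 d)) (𝓡 m) ∞ T (x, w) := fun x w => hP.contMDiffAt_chart hψ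
  let s : EuclideanSpace ℝ (Fin m) × EuclideanSpace ℝ (Fin d) → EuclideanSpace ℝ (Fin m) :=
    fun p => φ (T (φ.symm p.1, p.2))
  have hs : ContDiffAt ℝ ∞ s (φ x₀, w₀) := by
    refine ContMDiffAt.contDiffAt_comp_symm_prod (f := φ ∘ T) hφ hxφ ?_
    exact ContMDiffAt.comp_of_eq (contMDiffAt_of_mem_maximalAtlas hφ hxφ)
      (hT x₀ w₀ hx₀ hw₀t (hw₀s ▸ hx₀)) hT₀
  set C := ‖fderiv ℝ s (φ x₀, w₀)‖ + 1
  have hC : 0 < C := by positivity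
  have hs_ev : ∀ᶠ p in 𝓝 (φ x₀, w₀), DifferentiableAt ℝ s p ∧ ‖fderiv ℝ s p‖ < C := by
    have h₁ : ContDiffAt ℝ 1 s (φ x₀, w₀) := hs.of_le (by simp)
    have h₂ : ContinuousAt (fderiv ℝ s) (φ x₀, w₀) :=
      (h₁.fderiv_right (m := 0) (by simp)).continuousAt
    filter_upwards [h₁.eventually (by simp), h₂.norm.eventually_lt_const (lt_add_one _)]
      with p hp hp'
    exact ⟨hp.differentiableAt one_ne_zero, hp'⟩
  have hev : ∀ᶠ p : M × EuclideanSpace ℝ (Fin d) in 𝓝 (x₀, w₀),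
      (p.1 ∈ φ.source ∧ π₀ p.1 ∈ U) ∧ (p.2 ∈ ψ.target ∧ ψ.symm p.2 ∈ U) ∧ T p ∈ K ∧
      DifferentiableAt ℝ s (φ p.1, p.2) ∧ ‖fderiv ℝ s (φ p.1, p.2)‖ < C := by
    refine .and ?_ (.and ?_ (.and ?_ ?_))
    · exact (continuousAt_fst (p := (x₀, w₀))).eventually ((φ.open_source.eventually_mem hxφ).and
        (π₀.contMDiff.continuous.continuousAt.eventually (hP.isOpen.eventually_mem hx₀)))
    · exact (continuousAt_snd (p := (x₀, w₀))).eventually ((ψ.open_target.eventually_mem hw₀t).and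
        ((ψ.symm.continuousAt hw₀t).eventually (hP.isOpen.eventually_mem (hw₀s ▸ hx₀))))
    · exact (hT x₀ w₀ hx₀ hw₀t (hw₀s ▸ hx₀)).continuousAt.eventually (by rwa [hT₀])
    · have : ContinuousAt (fun p : M × EuclideanSpace ℝ (Fin d) => (φ p.1, p.2)) (x₀, w₀) :=
        (ContinuousAt.comp (f := Prod.fst) (x := (x₀, w₀)) (φ.continuousAt hxφ)
          continuousAt_fst).prodMk continuousAt_snd
      exact this.eventually hs_ev
  obtain ⟨V, hV, W, hW, hVW⟩ := mem_nhds_prod_iff.1 hev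
  obtain ⟨r, hr, hrW⟩ := Metric.mem_nhds_iff.1 hW
  refine ⟨V, hV, r, hr, ?_⟩
  -- The derivative in question is `D (ψ ∘ π ∘ φ.symm)` composed with a map of norm at most `C`, so
  -- closeness `1 / (2 * C)` of first derivatives on `K` gives the bound `1 / 2`.
  filter_upwards [smoothNhd_mem_nhds π₀ hφ hψ hKc (fun x hx => (hKsub hx).1)
    (fun x hx => (hKsub hx).2) 1 (show 0 < 1 / (2 * C) by positivity)] with π hπ x hx w hw
  obtain ⟨⟨hxs, hxU⟩, ⟨hwt, hwU⟩, hTK, hds, hdC⟩ := hVW (Set.mk_mem_prod hx (hrW hw))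
  simp only at hxs hxU hwt hwU hds hdC
  refine ⟨hπ.1 hTK, ?_⟩
  set D := fderiv ℝ s (φ x, w) ∘L ContinuousLinearMap.inr ℝ _ _
  have hD : HasFDerivAt (fun v => s (φ x, v)) D w :=
    hds.hasFDerivAt.comp w (hasFDerivAt_prodMk_right (φ x) w)
  have hDC : ‖D‖ ≤ C := by
    refine (ContinuousLinearMap.opNorm_comp_le _ _).trans ?_
    exact (mul_le_of_le_one_right (norm_nonneg _)
      (ContinuousLinearMap.norm_inr_le_one ℝ _ _)).trans hdC.le
  have hsT : s (φ x, w) = φ (T (x, w)) := by simp only [s, φ.left_inv hxs]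
  have hTs : T (x, w) ∈ φ.source := (hKsub hTK).1
  have hTev : ∀ᶠ v in 𝓝 w, T (x, v) ∈ φ.source :=
    ((hT x w hxU hwt hwU).continuousAt.comp
      (continuousAt_const.prodMk continuousAt_id : ContinuousAt (fun v => (x, v)) w)).eventually
      (φ.open_source.eventually_mem hTs)
  have key : ∀ g : C^∞⟮𝓡 m, M; 𝓡 d, B⟯, g (T (x, w)) ∈ ψ.source →
      HasFDerivAt (fun v => ψ (g (P x (ψ.symm v))))
        (fderiv ℝ (ψ ∘ g ∘ φ.symm) (φ (T (x, w))) ∘L D) w := by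
    intro g hg
    have h₁ := ((contDiffAt_chart_comp g hφ hψ hTs hg).differentiableAt (by simp)).hasFDerivAt
    rw [← hsT] at h₁ ⊢
    refine (h₁.comp w hD).congr_of_eventuallyEq ?_
    filter_upwards [hTev] with v hv
    simp only [Function.comp_apply, s, φ.left_inv hxs, φ.left_inv hv, T]
  -- Along the transport, `ψ ∘ π₀` is the chart coordinate of the fiber reached.
  have hid : fderiv ℝ (ψ ∘ π₀ ∘ φ.symm) (φ (T (x, w))) ∘L D = ContinuousLinearMap.id ℝ _ := by
    refine (key π₀ (hKsub hTK).2).unique ((hasFDerivAt_id w).congr_of_eventuallyEq ?_)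
    filter_upwards [ψ.open_target.eventually_mem hwt,
      (ψ.symm.continuousAt hwt).eventually (hP.isOpen.eventually_mem hwU)] with v hv hvU
    rw [hP.map_eq x _ hxU hvU, ψ.right_inv hv, id]
  refine ⟨_, key π (hπ.1 hTK), ?_⟩
  rw [← hid, ← ContinuousLinearMap.sub_comp]
  have hle : ‖fderiv ℝ (ψ ∘ π ∘ φ.symm) (φ (T (x, w))) -
      fderiv ℝ (ψ ∘ π₀ ∘ φ.symm) (φ (T (x, w)))‖ ≤ 1 / (2 * C) := by
    rw [← norm_iteratedFDeriv_one_sub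
      ((contDiffAt_chart_comp π hφ hψ hTs (hπ.1 hTK)).of_le (by simp))
      ((contDiffAt_chart_comp π₀ hφ hψ hTs (hKsub hTK).2).of_le (by simp))]
    exact (hπ.2 1 le_rfl _ hTK).le
  refine (ContinuousLinearMap.opNorm_comp_le _ _).trans
    ((mul_le_mul hle hDC (norm_nonneg _) (by positivity)).trans_eq ?_)
  field_simp

end FiberDerivative

/-! ### Maps with derivative close to the identity -/

section NearIdentity

variable {E : Type*} [NormedAddCommGroup E] [NormedSpace ℝ E]

theorem ContinuousLinearMap.isInvertible_of_norm_sub_id_le [CompleteSpace E] {L : E →L[ℝ] E}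
    (hL : ‖L - ContinuousLinearMap.id ℝ E‖ ≤ 1 / 2) : L.IsInvertible := by
  have h : ‖ContinuousLinearMap.id ℝ E - L‖ < 1 := by
    rw [norm_sub_rev]
    linarith
  refine ⟨ContinuousLinearEquiv.unitsEquiv ℝ E (Units.oneSub _ h), ?_⟩
  ext x
  simp [ContinuousLinearMap.one_def]

variable {h : E → E} {w₀ : E} {r : ℝ}

theorem norm_sub_sub_le_of_hasFDerivAt_near_id
    (hd : ∀ w ∈ Metric.ball w₀ r, ∃ L : E →L[ℝ] E,
      HasFDerivAt h L w ∧ ‖L - ContinuousLinearMap.id ℝ E‖ ≤ 1 / 2)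
    {x y : E} (hx : x ∈ Metric.ball w₀ r) (hy : y ∈ Metric.ball w₀ r) :
    ‖h y - h x - (y - x)‖ ≤ 1 / 2 * ‖y - x‖ := by
  choose! L hL hLn using hd
  exact (convex_ball w₀ r).norm_image_sub_le_of_norm_hasFDerivWithin_le'
    (φ := ContinuousLinearMap.id ℝ E) (fun w hw => (hL w hw).hasFDerivWithinAt) hLn hx hy

/-- A map with derivative close to the identity on a ball, and which moves the centre little,
takes the value `w₀` exactly once on the ball. Existence is the contraction principle for
`w ↦ w - h w + w₀` on a smaller closed ball. -/
theorem existsUnique_eq_center_of_hasFDerivAt_near_id [CompleteSpace E] (hr : 0 < r)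
    (hd : ∀ w ∈ Metric.ball w₀ r, ∃ L : E →L[ℝ] E,
      HasFDerivAt h L w ∧ ‖L - ContinuousLinearMap.id ℝ E‖ ≤ 1 / 2)
    (h₀ : ‖h w₀ - w₀‖ ≤ r / 4) : ∃! w, w ∈ Metric.ball w₀ r ∧ h w = w₀ := by
  have hlip := @norm_sub_sub_le_of_hasFDerivAt_near_id E _ _ h w₀ r hd
  have hsub : Metric.closedBall w₀ (r / 2) ⊆ Metric.ball w₀ r :=
    Metric.closedBall_subset_ball (by linarith)
  have hmaps : Set.MapsTo (fun w => w - h w + w₀) (Metric.closedBall w₀ (r / 2))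
      (Metric.closedBall w₀ (r / 2)) := by
    intro w hw
    have h₁ := hlip (hsub hw) (Metric.mem_ball_self hr)
    rw [mem_closedBall_iff_norm] at hw ⊢
    calc ‖w - h w + w₀ - w₀‖ = ‖(h w₀ - h w - (w₀ - w)) - (h w₀ - w₀)‖ := by congr 1; abel
      _ ≤ 1 / 2 * ‖w₀ - w‖ + r / 4 := (norm_sub_le _ _).trans (add_le_add h₁ h₀)
      _ ≤ r / 2 := by rw [norm_sub_rev]; linarith
  have hcontr : ContractingWith (1 / 2) (hmaps.restrict _ _ _) := by
    refine ⟨by rw [div_lt_one] <;> norm_num, LipschitzWith.of_dist_le_mul fun x y => ?_⟩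
    rw [Subtype.dist_eq, Subtype.dist_eq, dist_eq_norm, dist_eq_norm]
    have h₁ := hlip (hsub x.2) (hsub y.2)
    rw [norm_sub_rev (y : E),
      show h y - h x - ((y : E) - x) = (x - h x + w₀) - (y - h y + w₀) by abel] at h₁
    simpa using h₁
  obtain ⟨w, hw, hfix, -⟩ := hcontr.exists_fixedPoint' Metric.isClosed_closedBall.isComplete hmaps
    (Metric.mem_closedBall_self (by linarith : 0 ≤ r / 2)) (edist_ne_top _ _)
  have hw' : h w = w₀ := by
    have h₁ : w - h w + w₀ = w := hfix
    rw [sub_add, sub_eq_self, sub_eq_zero] at h₁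
    exact h₁
  refine ⟨w, ⟨hsub hw, hw'⟩, fun v hv => ?_⟩
  have h₁ := hlip (hsub hw) hv.1
  rw [hv.2, hw', sub_self, zero_sub, norm_neg] at h₁
  exact sub_eq_zero.1 (norm_le_zero_iff.1 (by linarith))

end NearIdentity

/-! ### Implicitly defined functions on a manifold -/

section ImplicitSection

/-- Smoothness of a function `σ` defined implicitly by `f (x, σ x) = a` near a point `x` of a
manifold, from invertibility of the partial derivative. -/
theorem contMDiffAt_of_implicit {m : ℕ} {M : Type u} [TopologicalSpace M]
    [ChartedSpace (EuclideanSpace ℝ (Fin m)) M] [IsManifold (𝓡 m) ∞ M]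
    {E : Type*} [NormedAddCommGroup E] [NormedSpace ℝ E] [CompleteSpace E]
    {f : M × E → E} {σ : M → E} {x : M} {a : E} {L : E →L[ℝ] E}
    (hf : ContMDiffAt ((𝓡 m).prod 𝓘(ℝ, E)) 𝓘(ℝ, E) ∞ f (x, σ x))
    (hL : HasFDerivAt (fun w => f (x, w)) L (σ x)) (hLinv : L.IsInvertible)
    (hx : f (x, σ x) = a) (hσ : ∀ᶠ p in 𝓝 (x, σ x), f p = a → p.2 = σ p.1) :
    ContMDiffAt (𝓡 m) 𝓘(ℝ, E) ∞ σ x := by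
  set φ := chartAt (EuclideanSpace ℝ (Fin m)) x
  have hφ : φ ∈ IsManifold.maximalAtlas (𝓡 m) ∞ M := IsManifold.chart_mem_maximalAtlas x
  have hxφ : x ∈ φ.source := mem_chart_source _ x
  let F : EuclideanSpace ℝ (Fin m) × E → E := fun p => f (φ.symm p.1, p.2)
  have hF : ContDiffAt ℝ ∞ F (φ x, σ x) := hf.contDiffAt_comp_symm_prod hφ hxφ
  have hpart : fderiv ℝ F (φ x, σ x) ∘L ContinuousLinearMap.inr ℝ _ _ = L := by
    have h₁ := ((hF.differentiableAt (by simp)).hasFDerivAt).comp (σ x)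
      (hasFDerivAt_prodMk_right (φ x) (σ x))
    have h₂ : F ∘ (fun w => (φ x, w)) = fun w => f (x, w) := by
      ext w
      simp [F, φ.left_inv hxφ]
    rw [h₂] at h₁
    exact h₁.unique hL
  have hinv : (fderiv ℝ F (φ x, σ x) ∘L ContinuousLinearMap.inr ℝ _ _).IsInvertible := by
    rwa [hpart]
  set τ := hF.implicitFunction (by simp) hinv
  have hτ : ContDiffAt ℝ ∞ τ (φ x) := hF.contDiffAt_implicitFunction (by simp) hinv
  have hτx : τ (φ x) = σ x := hF.implicitFunction_apply_self (by simp) hinv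
  have hτF : ∀ᶠ z in 𝓝 (φ x), F (z, τ z) = F (φ x, σ x) :=
    hF.eventually_apply_implicitFunction (by simp) hinv
  have hτφ : ContMDiffAt (𝓡 m) 𝓘(ℝ, E) ∞ (τ ∘ φ) x :=
    hτ.contMDiffAt.comp x (contMDiffAt_of_mem_maximalAtlas hφ hxφ)
  -- Uniqueness identifies `σ` with the implicit function `τ`, whose graph is continuous at `x`,
  -- so continuity of `σ` need not be assumed.
  refine hτφ.congr_of_eventuallyEq ?_
  have hgraph : ContinuousAt (fun y => (y, τ (φ y))) x :=
    continuousAt_id.prodMk hτφ.continuousAt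
  have hσ' : ∀ᶠ p in 𝓝 (x, τ (φ x)), f p = a → p.2 = σ p.1 := by rwa [hτx]
  filter_upwards [hgraph.eventually hσ', (φ.continuousAt hxφ).eventually hτF,
    φ.open_source.eventually_mem hxφ] with y hy hyF hyφ
  simp only [F, φ.left_inv hyφ, φ.left_inv hxφ, hx] at hyF
  exact (hy hyF).symm

end ImplicitSection

/-! ### Fibers of nearby fibrations -/

section NearbyFibration

variable {m d : ℕ}
  {M : Type u} [TopologicalSpace M] [ChartedSpace (EuclideanSpace ℝ (Fin m)) M]
  {B : Type v} [TopologicalSpace B] [ChartedSpace (EuclideanSpace ℝ (Fin d)) B]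
  {ψ : OpenPartialHomeomorph B (EuclideanSpace ℝ (Fin d))}
  {U : Set B} {P : M → B → M}

/-- If along the transport of `π₀` the map `π` is close to `π₀` near `b`, in the sense that the
maps `w ↦ ψ (π (P x (ψ.symm w)))` are `C¹`-close to the identity, then every point `x` over `U` can
be moved in a unique way into `π ⁻¹ (b)`, and this identifies the fibers of `π₀` and `π` over
`b`. -/
theorem IsTransport.diffeomorphicSubsets_of_near [IsManifold (𝓡 m) ∞ M] [IsManifold (𝓡 d) ∞ B]
    {π₀ π : C^∞⟮𝓡 m, M; 𝓡 d, B⟯} (hP : IsTransport π₀ U P)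
    (hψ : ψ ∈ IsManifold.maximalAtlas (𝓡 d) ∞ B) {b : B} (hbU : b ∈ U) (hbψ : b ∈ ψ.source)
    {r : ℝ} (hr : 0 < r)
    (hball : ∀ w ∈ Metric.ball (ψ b) r, w ∈ ψ.target ∧ ψ.symm w ∈ U)
    (hd : ∀ x, π₀ x = b → ∀ w ∈ Metric.ball (ψ b) r, π (P x (ψ.symm w)) ∈ ψ.source ∧
      ∃ L : EuclideanSpace ℝ (Fin d) →L[ℝ] EuclideanSpace ℝ (Fin d),
        HasFDerivAt (fun w => ψ (π (P x (ψ.symm w)))) L w ∧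
          ‖L - ContinuousLinearMap.id ℝ _‖ ≤ 1 / 2)
    (hclose : ∀ x, π₀ x = b → ‖ψ (π x) - ψ b‖ ≤ r / 4)
    (hfar : ∀ x, π x = b → π₀ x ∈ ψ.source ∧ ψ (π₀ x) ∈ Metric.ball (ψ b) r) :
    DiffeomorphicSubsets m {x | π₀ x = b} {x | π x = b} := by
  have hψb : ψ.symm (ψ b) = b := ψ.left_inv hbψ
  -- A point over `U` and its transport to the fiber over `b` are moved along the same points, so
  -- the estimates extend from the fiber to all of `π₀ ⁻¹ (U)`.
  have hPb : ∀ x, π₀ x ∈ U → ∀ w ∈ Metric.ball (ψ b) r,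
      P (P x b) (ψ.symm w) = P x (ψ.symm w) :=
    fun x hx w hw => hP.comp x b _ hx hbU (hball w hw).2
  have hd' : ∀ x, π₀ x ∈ U → ∀ w ∈ Metric.ball (ψ b) r, π (P x (ψ.symm w)) ∈ ψ.source ∧
      ∃ L : EuclideanSpace ℝ (Fin d) →L[ℝ] EuclideanSpace ℝ (Fin d),
        HasFDerivAt (fun w => ψ (π (P x (ψ.symm w)))) L w ∧
          ‖L - ContinuousLinearMap.id ℝ _‖ ≤ 1 / 2 := by
    intro x hx w hw
    obtain ⟨h₁, L, hL, hLn⟩ := hd (P x b) (hP.map_eq x b hx hbU) w hw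
    rw [hPb x hx w hw] at h₁
    refine ⟨h₁, L, hL.congr_of_eventuallyEq ?_, hLn⟩
    filter_upwards [Metric.isOpen_ball.eventually_mem hw] with v hv
    rw [hPb x hx v hv]
  have hex : ∀ x, π₀ x ∈ U →
      ∃! w, w ∈ Metric.ball (ψ b) r ∧ ψ (π (P x (ψ.symm w))) = ψ b := by
    intro x hx
    refine existsUnique_eq_center_of_hasFDerivAt_near_id hr (fun w hw => (hd' x hx w hw).2) ?_
    rw [hψb]
    exact hclose _ (hP.map_eq x b hx hbU)
  -- `σ` is defined on the open set `π₀ ⁻¹ (U)`, where it is shown to be smooth, and not only on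
  -- the fiber; thus `x ↦ P x (ψ.symm (σ x))` is itself a smooth extension to an open set.
  choose! σ hσ hσu using hex
  simp only at hσ hσu
  have hUo : IsOpen (π₀ ⁻¹' U) := hP.isOpen.preimage π₀.contMDiff.continuous
  have hσs : ∀ x ∈ π₀ ⁻¹' U, ContMDiffAt (𝓡 m) (𝓡 d) ∞ σ x := by
    intro x hx
    obtain ⟨hball', hσx⟩ := hσ x hx
    obtain ⟨hsrc, L, hL, hLn⟩ := hd' x hx _ hball'
    refine contMDiffAt_of_implicit (a := ψ b)
      (f := fun p : M × EuclideanSpace ℝ (Fin d) => ψ (π (P p.1 (ψ.symm p.2)))) ?_ hL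
      (ContinuousLinearMap.isInvertible_of_norm_sub_id_le hLn) hσx ?_
    · have h₁ := hP.contMDiffAt_chart hψ hx (hball _ hball').1 (hball _ hball').2
      have h₂ : ContMDiffAt (𝓡 m) (𝓡 d) ∞ (ψ ∘ π) (P x (ψ.symm (σ x))) :=
        (contMDiffAt_of_mem_maximalAtlas hψ hsrc).comp _ (π.contMDiff _)
      exact ContMDiffAt.comp (g := ψ ∘ π) (x, σ x) h₂ h₁
    · filter_upwards [(hUo.prod Metric.isOpen_ball).mem_nhds (Set.mk_mem_prod hx hball')]
        with p hp hpb
      exact hσu p.1 hp.1 p.2 ⟨hp.2, hpb⟩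
  have hfarU : ∀ x, π x = b → π₀ x ∈ U := by
    intro x hx
    have h₁ := (hball _ (hfar x hx).2).2
    rwa [ψ.left_inv (hfar x hx).1] at h₁
  refine .of_contMDiffAt (f := fun x => P x (ψ.symm (σ x))) (g := fun x => P x b) hUo
    (fun x hx => ?_) hfarU (fun x hx => ?_) (fun x hx => hP.contMDiffAt_left hx hbU)
    (fun x hx => ?_) (fun x hx => hP.map_eq x b (hfarU x hx) hbU) (fun x hx => ?_)
    (fun x hx => ?_)
  · rwa [Set.mem_preimage, show π₀ x = b from hx]
  · obtain ⟨hball', -⟩ := hσ x hx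
    have h₁ := hP.contMDiffAt_chart hψ hx (hball _ hball').1 (hball _ hball').2
    exact ContMDiffAt.comp x h₁ (contMDiffAt_id.prodMk (hσs x hx))
  · have hxU : π₀ x ∈ U := by rwa [show π₀ x = b from hx]
    exact ψ.injOn (hd' x hxU _ (hσ x hxU).1).1 hbψ (hσ x hxU).2
  · have hxU : π₀ x ∈ U := by rwa [show π₀ x = b from hx]
    rw [hP.comp x _ b hxU (hball _ (hσ x hxU).1).2 hbU, ← show π₀ x = b from hx, hP.self x hxU]
  · have hxU := hfarU x hx
    have hmem : π₀ (P x b) ∈ U := by rwa [hP.map_eq x b hxU hbU]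
    have hmove : P (P x b) (ψ.symm (ψ (π₀ x))) = x := by
      rw [ψ.left_inv (hfar x hx).1, hP.comp x b _ hxU hbU hxU, hP.self x hxU]
    have h₁ : ψ (π₀ x) = σ (P x b) := by
      refine hσu _ hmem _ ⟨(hfar x hx).2, ?_⟩
      rw [hmove, show π x = b from hx]
    rw [← h₁, hmove]

/-- Fibrations near `π₀` have the same fiber over `b` as `π₀`, up to diffeomorphism. -/
theorem IsFibration.eventually_diffeomorphicSubsets [IsManifold (𝓡 m) ∞ M]
    [IsManifold (𝓡 d) ∞ B] [T2Space M] [CompactSpace M] [T1Space B]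
    {π₀ : C^∞⟮𝓡 m, M; 𝓡 d, B⟯} (hπ₀ : IsFibration π₀) (b : B) :
    ∀ᶠ π : C^∞⟮𝓡 m, M; 𝓡 d, B⟯ in @nhds _ (smoothTopology m d M B) π₀,
      DiffeomorphicSubsets m {x | π₀ x = b} {x | π x = b} := by
  obtain ⟨U, P, hbU, hP⟩ := hπ₀.exists_isTransport b
  set ψ := chartAt (EuclideanSpace ℝ (Fin d)) b
  have hψ : ψ ∈ IsManifold.maximalAtlas (𝓡 d) ∞ B := IsManifold.chart_mem_maximalAtlas b
  have hbψ : b ∈ ψ.source := mem_chart_source _ b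
  have hπ₀c : Continuous π₀ := π₀.contMDiff.continuous
  have hK : IsCompact {x | π₀ x = b} := (isClosed_singleton.preimage hπ₀c).isCompact
  -- The derivative estimate, local in `x`, holds along the whole fiber by compactness.
  obtain ⟨r₁, hr₁, hd⟩ : ∃ r > 0,
      ∀ᶠ π : C^∞⟮𝓡 m, M; 𝓡 d, B⟯ in @nhds _ (smoothTopology m d M B) π₀,
        ∀ x ∈ {x | π₀ x = b}, ∀ w ∈ Metric.ball (ψ b) r, π (P x (ψ.symm w)) ∈ ψ.source ∧
          ∃ L : EuclideanSpace ℝ (Fin d) →L[ℝ] EuclideanSpace ℝ (Fin d),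
            HasFDerivAt (fun w => ψ (π (P x (ψ.symm w)))) L w ∧
              ‖L - ContinuousLinearMap.id ℝ _‖ ≤ 1 / 2 := by
    refine hK.induction_on (p := fun s => ∃ r > 0,
      ∀ᶠ π : C^∞⟮𝓡 m, M; 𝓡 d, B⟯ in @nhds _ (smoothTopology m d M B) π₀,
        ∀ x ∈ s, ∀ w ∈ Metric.ball (ψ b) r, π (P x (ψ.symm w)) ∈ ψ.source ∧
          ∃ L : EuclideanSpace ℝ (Fin d) →L[ℝ] EuclideanSpace ℝ (Fin d),
            HasFDerivAt (fun w => ψ (π (P x (ψ.symm w)))) L w ∧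
              ‖L - ContinuousLinearMap.id ℝ _‖ ≤ 1 / 2) ⟨1, one_pos, by simp⟩ ?_ ?_ ?_
    · rintro s t hst ⟨r, hr, ht⟩
      exact ⟨r, hr, ht.mono fun π h x hx => h x (hst hx)⟩
    · rintro s t ⟨r, hr, hs⟩ ⟨r', hr', ht⟩
      refine ⟨min r r', lt_min hr hr', ?_⟩
      filter_upwards [hs, ht] with π h h' x hx w hw
      rcases hx with hx | hx
      · exact h x hx w (Metric.ball_subset_ball (min_le_left _ _) hw)
      · exact h' x hx w (Metric.ball_subset_ball (min_le_right _ _) hw)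
    · rintro x rfl
      obtain ⟨V, hV, r, hr, h⟩ := hP.eventually_norm_fderiv_sub_id_le hψ x hbU hbψ
      exact ⟨V, mem_nhdsWithin_of_mem_nhds hV, r, hr, h⟩
  obtain ⟨r₂, hr₂, hball⟩ : ∃ r > 0,
      ∀ w ∈ Metric.ball (ψ b) r, w ∈ ψ.target ∧ ψ.symm w ∈ U :=
    Metric.eventually_nhds_iff_ball.1 ((ψ.open_target.eventually_mem (ψ.map_source hbψ)).and
      ((ψ.symm.continuousAt (ψ.map_source hbψ)).eventually
        (hP.isOpen.eventually_mem (by rwa [ψ.left_inv hbψ]))))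
  set r := min r₁ r₂
  have hr : 0 < r := lt_min hr₁ hr₂
  have hO : ∀ ρ, IsOpen (ψ.source ∩ ψ ⁻¹' Metric.ball (ψ b) ρ) := fun ρ =>
    ψ.continuousOn.isOpen_inter_preimage ψ.open_source Metric.isOpen_ball
  -- The first `C⁰` condition keeps the fiber of `π₀` close to that of `π`; the second one, on the
  -- compact complement of a tube around the fiber of `π₀`, keeps the fiber of `π` in the tube.
  filter_upwards [hd,
    eventually_mapsTo_smoothTopology π₀ hK (hO (r / 4)) (by
      intro x hx
      rw [show π₀ x = b from hx]
      exact ⟨hbψ, Metric.mem_ball_self (by positivity)⟩),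
    eventually_mapsTo_smoothTopology π₀ ((hO r).preimage hπ₀c).isClosed_compl.isCompact
      (isOpen_compl_singleton (x := b)) (by
      rintro x hx rfl
      exact hx ⟨hbψ, Metric.mem_ball_self hr⟩)] with π hπd hπK hπfar
  refine hP.diffeomorphicSubsets_of_near hψ hbU hbψ hr
    (fun w hw => hball w (Metric.ball_subset_ball (min_le_right _ _) hw))
    (fun x hx w hw => hπd x hx w (Metric.ball_subset_ball (min_le_left _ _) hw))
    (fun x hx => (mem_ball_iff_norm.1 (hπK hx).2).le) (fun x hx => ?_)
  by_contra h
  exact hπfar h hx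

end NearbyFibration

theorem mainTheorem3 {m d : ℕ}
    {M : Type u} [TopologicalSpace M] [ChartedSpace (EuclideanSpace ℝ (Fin m)) M]
    [IsManifold (𝓡 m) ∞ M] [T2Space M] [CompactSpace M]
    {B : Type v} [TopologicalSpace B] [ChartedSpace (EuclideanSpace ℝ (Fin d)) B]
    [IsManifold (𝓡 d) ∞ B] [T2Space B] [CompactSpace B]
    (π₀ π₁ : Fib m d M B) (h : π₁ ∈ connectedComponent π₀)
    (b b' : B) (hb : b' ∈ connectedComponent b) :
    DiffeomorphicSubsets m (π₀.fiber b) (π₁.fiber b') := by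
  refine .trans ?_ (π₁.diffeomorphicSubsets_fiber hb)
  refine rel_of_mem_connectedComponent
    (r := fun π π' : Fib m d M B => DiffeomorphicSubsets m (π.fiber b) (π'.fiber b))
    ⟨fun _ => .refl _, fun h => h.symm, fun h h' => h.trans h'⟩ (fun π => ?_) h
  let _ := smoothTopology m d M B
  exact continuous_induced_dom.continuousAt.eventually (π.2.eventually_diffeomorphicSubsets b)
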